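/- Let $(R,\mathfrak m)$ be a Noetherian local ring with residue field $k=R/\mathfrak m$ and let $I\subseteq R$ be an ideal. For a finitely generated $R$-module $M$ write $\beta_i^R(M)=\dim_k \operatorname{Tor}_i^R(M,k)$ for its $i$-th Betti number. The Hilbert function of an ideal $J\subseteq R$ is $$\mathrm{HF}_{R/J}(n)=\dim_k\bigl(\mathfrak m^n(R/J)/\mathfrak m^{n+1}(R/J)\bigr),\qquad n\ge 0,$$ and $J\equiv I \bmod \mathfrak m^N$ means $J+\mathfrak m^N=I+\mathfrak m^N$. 1. For every integer $p\ge 0$ there exists an integer $N>0$ such that, for every ideal $J\subseteq R$ with $J\equiv I\bmod \mathfrak m^N$ and $\mathrm{HF}_{R/J}=\mathrm{HF}_{R/I}$, one has $\beta_i^R(R/I)=\beta_i^R(R/J)$ for all $0\le i\le p$. 2. There exists an integer $N_0$ such that for every $N\ge N_0$ and every ideal $J\subseteq R$ with $J\equiv I\bmod \mathfrak m^N$ and $\mathrm{HF}_{R/J}=\mathrm{HF}_{R/I}$, the $R$-modules $R/I$ and $R/J$ have the same projective dimension (possibly infinite). -/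

import Mathlib

universe u

open CategoryTheory IsLocalRing

noncomputable section

namespace BettiPerturbation

variable (R : Type u) [CommRing R]

/-- The `R`-module `Tor_i^R(M, N)`: the homology in degree `i` of `P ⊗ N`, where `P` is a
projective resolution of `M`. -/
abbrev TorModule (M N : Type u) [AddCommGroup M] [Module R M] [AddCommGroup N] [Module R N]
    (i : ℕ) : ModuleCat.{u} R :=
  ((Tor' (ModuleCat.{u} R) i).obj (ModuleCat.of R M)).obj (ModuleCat.of R N)

/-- If `a` annihilates `N`, then `a` annihilates `Tor_i^R(M, N)`. -/
theorem smul_tor_eq_zero (M N : Type u) [AddCommGroup M] [Module R M]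
    [AddCommGroup N] [Module R N] (a : R) (ha : ∀ y : N, a • y = 0) (i : ℕ)
    (x : TorModule R M N i) : a • x = 0 := by
  let F := (MonoidalCategory.tensoringRight (ModuleCat.{u} R)).obj (ModuleCat.of R N)
  let P := projectiveResolution (ModuleCat.of R M)
  let K := (F.mapHomologicalComplex _).obj P.complex
  have hK (j : ℕ) : a • 𝟙 (K.X j) = 0 := by
    ext z
    change a • (show TensorProduct R (P.complex.X j) N from z) = 0
    induction z using TensorProduct.induction_on with
    | zero => exact smul_zero a
    | tmul y n => rw [← TensorProduct.tmul_smul, ha, TensorProduct.tmul_zero]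
    | add y z hy hz => exact (smul_add a _ _).trans (by rw [hy, hz, add_zero])
  have hc : a • 𝟙 (K.cycles i) = 0 := by
    rw [← cancel_mono (K.iCycles i), Linear.smul_comp, Category.id_comp, Limits.zero_comp,
      ← Category.comp_id (K.iCycles i), ← Linear.comp_smul, hK, Limits.comp_zero]
  have hh : a • 𝟙 (K.homology i) = 0 := by
    rw [← cancel_epi (K.homologyπ i), Linear.comp_smul, Category.comp_id, Limits.comp_zero,
      ← Category.id_comp (K.homologyπ i), ← Linear.smul_comp, hc, Limits.zero_comp]
  let e := P.isoLeftDerivedObj F i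
  have hT : a • 𝟙 ((F.leftDerived i).obj (ModuleCat.of R M)) = 0 := by
    rw [← cancel_mono e.hom, Linear.smul_comp, Category.id_comp, Limits.zero_comp,
      ← Category.comp_id e.hom, ← Linear.comp_smul]
    exact (congrArg (e.hom ≫ ·) hh).trans Limits.comp_zero
  exact congrArg (fun f => f.hom x) hT

variable [IsLocalRing R]

/-- The `k`-vector space structure on `Tor_i^R(M, k)`, where `k` is the residue field of the local
ring `R`: it is the one that induces the given `R`-module structure. -/
instance torResidueFieldModule (M : Type u) [AddCommGroup M] [Module R M] (i : ℕ) :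
    Module (ResidueField R) (TorModule R M (ResidueField R) i) :=
  Module.IsTorsionBySet.module (I := maximalIdeal R) fun x a =>
    smul_tor_eq_zero R M (ResidueField R) a
      (fun y => by
        rw [Algebra.smul_def, ResidueField.algebraMap_eq, (residue_eq_zero_iff _).2 a.2,
          zero_mul]) i x

/-- The `i`-th Betti number `β_i^R(M) = dim_k Tor_i^R(M, k)` of a finitely generated module `M`
over a Noetherian local ring `R` with residue field `k`. -/
def bettiNumber (M : Type u) [AddCommGroup M] [Module R M] (i : ℕ) : ℕ :=
  Module.finrank (ResidueField R) (TorModule R M (ResidueField R) i)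

/-- The degree `n` component `𝔪ⁿM / 𝔪ⁿ⁺¹M` of the associated graded module `gr_𝔪(M)`. -/
abbrev GradedPiece (M : Type u) [AddCommGroup M] [Module R M] (n : ℕ) : Type u :=
  (maximalIdeal R ^ n • ⊤ : Submodule R M) ⧸
    (maximalIdeal R • ⊤ : Submodule R (maximalIdeal R ^ n • ⊤ : Submodule R M))

instance gradedPieceModule (M : Type u) [AddCommGroup M] [Module R M] (n : ℕ) :
    Module (ResidueField R) (GradedPiece R M n) :=
  inferInstanceAs (Module (R ⧸ maximalIdeal R) (GradedPiece R M n))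

variable {R}

/-- The Hilbert function of an ideal `I` of a Noetherian local ring `(R, 𝔪, k)`, that is, the
Hilbert function `n ↦ dim_k (𝔪ⁿ(R/I) / 𝔪ⁿ⁺¹(R/I))` of `R/I`. -/
def hilbertFunction (I : Ideal R) (n : ℕ) : ℕ :=
  Module.finrank (ResidueField R) (GradedPiece R (R ⧸ I) n)

/-- `I ≡ J mod 𝔪^N`, that is, `I + 𝔪^N = J + 𝔪^N`. -/
def CongrModPow (I J : Ideal R) (N : ℕ) : Prop :=
  I ⊔ maximalIdeal R ^ N = J ⊔ maximalIdeal R ^ N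

/-- The projective dimension of `R/I` as an `R`-module: `⊤` if it is infinite, `⊥` if `R/I = 0`. -/
def projDimQuotient (I : Ideal R) : WithBot ℕ∞ :=
  projectiveDimension (ModuleCat.of R (R ⧸ I))

end BettiPerturbation

end

/-!
Call `L, L' ≤ E` close with gain `c` if every element of one of them of `𝔪`-adic order at least `n`
agrees with an element of the other one up to order `n + c`, for all `n`. By Artin–Rees, a
congruence `L ≤ L' + 𝔪^N E` with `N` large gives half of this. In particular the initial forms of
`L` are among those of `L'`, and if the Hilbert functions coincide, they are the same. Therefore
the Artin–Rees bound of `L` is also one for `L'`, which gives the other half.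

Closeness is inherited by relation modules: if `L` is presented by `φ : F → L` and `L'` is close
to `L`, then perturbing `φ` gives a presentation of `L'`, whose kernel is close to that of `φ`, the
loss of gain being an Artin–Rees bound of `L`. A minimal cover stays minimal under perturbation, so
its rank, the zeroth Betti number, does not change, and the higher Betti numbers are those of the
relation module. This gives finitely many Betti numbers at a time.

By Auslander–Buchsbaum, finite projective dimensions over `R` are bounded by the depth of `R`, so
that finitely many Betti numbers decide the projective dimension.
-/

noncomputable section

namespace BettiPerturbation

section AdicApproximation

variable {R : Type*} [CommRing R] {E F : Type*} [AddCommGroup E] [Module R E]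
  [AddCommGroup F] [Module R F]

/-- `d` is an Artin–Rees bound for `L ≤ E`: every element of `L` of `𝔞`-adic order at least `n`
lies in `𝔞ⁿ⁻ᵈ L`. The subtraction is truncated, so there is no condition for `n ≤ d`. -/
def IsArtinReesBound (𝔞 : Ideal R) (d : ℕ) (L : Submodule R E) : Prop :=
  ∀ n, L ⊓ 𝔞 ^ n • ⊤ ≤ 𝔞 ^ (n - d) • L

/-- `L` is `𝔞`-adically approximated by `L'` with a gain of `c`: elements of `L` of order at least
`n` agree with elements of `L'` up to order `n + c`. For `c = 1` this says that the initial forms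
of `L` in `gr_𝔞 E` are among those of `L'`. -/
def AdicApprox (𝔞 : Ideal R) (c : ℕ) (L L' : Submodule R E) : Prop :=
  ∀ n, L ⊓ 𝔞 ^ n • ⊤ ≤ L' ⊔ 𝔞 ^ (n + c) • ⊤

/-- `L` and `L'` approximate each other `𝔞`-adically with a gain of `c`. Unlike congruence modulo
`𝔞ᶜ`, this relation passes from submodules to the relations between their generators. -/
def AdicClose (𝔞 : Ideal R) (c : ℕ) (L L' : Submodule R E) : Prop :=
  AdicApprox 𝔞 c L L' ∧ AdicApprox 𝔞 c L' L

variable {𝔞 : Ideal R} {c c' d : ℕ} {L L' : Submodule R E}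

lemma pow_smul_top_anti {m n : ℕ} (h : m ≤ n) :
    (𝔞 ^ n • ⊤ : Submodule R E) ≤ 𝔞 ^ m • ⊤ :=
  Submodule.smul_mono_left (Ideal.pow_le_pow_right h)

lemma AdicApprox.mono (h : AdicApprox 𝔞 c' L L') (hc : c ≤ c') : AdicApprox 𝔞 c L L' :=
  fun n => (h n).trans (sup_le_sup_left (pow_smul_top_anti (by lia)) _)

lemma AdicApprox.le (h : AdicApprox 𝔞 c L L') : L ≤ L' ⊔ 𝔞 ^ c • ⊤ := by
  simpa using h 0

lemma AdicApprox.comap (h : AdicApprox 𝔞 c L L') (φ : F →ₗ[R] E)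
    (hφ : LinearMap.range φ ⊔ L' = ⊤) : AdicApprox 𝔞 c (L.comap φ) (L'.comap φ) := by
  rintro n x ⟨hxL, hxn⟩
  have hle : L' ⊔ 𝔞 ^ (n + c) • ⊤ ≤ L' ⊔ (𝔞 ^ (n + c) • ⊤ : Submodule R F).map φ := by
    rw [← hφ, Submodule.smul_sup, Submodule.map_smul'', Submodule.map_top]
    exact sup_le le_sup_left (sup_le le_sup_right (Submodule.smul_le_right.trans le_sup_left))
  have hφx : φ x ∈ (𝔞 ^ n • ⊤ : Submodule R E) :=
    Submodule.smul_top_le_comap_smul_top _ φ hxn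
  obtain ⟨l, hl, _, ⟨y, hy, rfl⟩, hxy⟩ := Submodule.mem_sup.1 (hle (h n ⟨hxL, hφx⟩))
  refine Submodule.mem_sup.2 ⟨x - y, ?_, y, hy, sub_add_cancel x y⟩
  rwa [Submodule.mem_comap, map_sub, ← hxy, add_sub_cancel_right]

lemma AdicClose.mono (h : AdicClose 𝔞 c' L L') (hc : c ≤ c') : AdicClose 𝔞 c L L' :=
  ⟨h.1.mono hc, h.2.mono hc⟩

lemma AdicClose.comap (h : AdicClose 𝔞 c L L') (φ : F →ₗ[R] E)
    (hL : LinearMap.range φ ⊔ L = ⊤) (hL' : LinearMap.range φ ⊔ L' = ⊤) :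
    AdicClose 𝔞 c (L.comap φ) (L'.comap φ) :=
  ⟨h.1.comap φ hL', h.2.comap φ hL⟩

lemma IsArtinReesBound.adicApprox (hL : IsArtinReesBound 𝔞 d L)
    (h : L ≤ L' ⊔ 𝔞 ^ (c + d) • ⊤) : AdicApprox 𝔞 c L L' := by
  intro n
  refine (hL n).trans ((smul_mono_right _ h).trans ?_)
  rw [Submodule.smul_sup, ← Submodule.mul_smul, ← pow_add]
  exact sup_le_sup Submodule.smul_le_right (pow_smul_top_anti (by lia))

lemma adicApprox_ker {φ ψ : F →ₗ[R] E} (hψ : IsArtinReesBound 𝔞 d (LinearMap.range ψ))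
    (h : LinearMap.range (φ - ψ) ≤ 𝔞 ^ (c + d) • ⊤) :
    AdicApprox 𝔞 c (LinearMap.ker φ) (LinearMap.ker ψ) := by
  rintro n x ⟨hx, hxn⟩
  have hmap : (𝔞 ^ n • ⊤ : Submodule R F).map (φ - ψ) ≤ 𝔞 ^ (n + (c + d)) • ⊤ := by
    rw [Submodule.map_smul'', pow_add, Submodule.mul_smul, Submodule.map_top]
    exact smul_mono_right _ h
  have hψx : ψ x ∈ (𝔞 ^ (n + (c + d)) • ⊤ : Submodule R E) := by
    have := hmap ⟨x, hxn, rfl⟩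
    rwa [LinearMap.sub_apply, LinearMap.mem_ker.1 hx, zero_sub, neg_mem_iff] at this
  have hψx' := hψ _ ⟨⟨x, rfl⟩, hψx⟩
  rw [LinearMap.range_eq_map, ← Submodule.map_smul''] at hψx'
  obtain ⟨y, hy, hyx⟩ := hψx'
  refine Submodule.mem_sup.2 ⟨x - y, ?_, y, pow_smul_top_anti (by lia) hy, sub_add_cancel x y⟩
  rw [LinearMap.mem_ker, map_sub, hyx, sub_self]

lemma exists_range_le_of_range_le_sup [Module.Projective R F] (φ : F →ₗ[R] E)
    {P : Submodule R E} (h : LinearMap.range φ ≤ L ⊔ P) :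
    ∃ ψ : F →ₗ[R] E, LinearMap.range ψ ≤ L ∧ LinearMap.range (φ - ψ) ≤ P := by
  let π := P.mkQ ∘ₗ L.subtype
  have hπ : LinearMap.range (P.mkQ ∘ₗ φ) ≤ LinearMap.range π := by
    simpa only [π, LinearMap.range_comp, Submodule.range_subtype, Submodule.map_sup,
      Submodule.mkQ_map_self, sup_bot_eq] using Submodule.map_mono (f := P.mkQ) h
  obtain ⟨ψ, hψ⟩ := Module.projective_lifting_property π.rangeRestrict
    ((P.mkQ ∘ₗ φ).codRestrict _ fun x => hπ ⟨x, rfl⟩) π.surjective_rangeRestrict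
  refine ⟨L.subtype ∘ₗ ψ, ?_, ?_⟩
  · rw [LinearMap.range_comp]
    exact Submodule.map_subtype_le L _
  · rintro _ ⟨x, rfl⟩
    have hx : P.mkQ (ψ x) = P.mkQ (φ x) := congrArg Subtype.val (LinearMap.congr_fun hψ x)
    exact (Submodule.Quotient.eq P).1 hx.symm

variable [IsNoetherianRing R] [Module.Finite R E]

lemma exists_isArtinReesBound (𝔞 : Ideal R) (L : Submodule R E) :
    ∃ d, IsArtinReesBound 𝔞 d L := by
  obtain ⟨d, hd⟩ := 𝔞.exists_pow_inf_eq_pow_smul L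
  refine ⟨d, fun n => ?_⟩
  rcases le_total n d with h | h
  · rw [Nat.sub_eq_zero_of_le h, pow_zero, one_smul]
    exact inf_le_left
  · rw [inf_comm, hd n h]
    exact smul_mono_right _ inf_le_right

lemma mem_of_forall_mem_sup_pow_smul (h𝔞 : 𝔞 ≤ (⊥ : Ideal R).jacobson) {x : E}
    (h : ∀ n, x ∈ L ⊔ 𝔞 ^ n • ⊤) : x ∈ L := by
  rw [← Submodule.Quotient.mk_eq_zero, ← Submodule.mem_bot R,
    ← Ideal.iInf_pow_smul_eq_bot_of_le_jacobson 𝔞 h𝔞, Submodule.mem_iInf]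
  intro n
  simpa only [Submodule.map_sup, Submodule.mkQ_map_self, bot_sup_eq, Submodule.map_smul'',
    Submodule.map_top, Submodule.range_mkQ, Submodule.mkQ_apply]
    using Submodule.mem_map_of_mem (f := L.mkQ) (h n)

lemma IsArtinReesBound.of_le_sup (h𝔞 : 𝔞 ≤ (⊥ : Ideal R).jacobson)
    (h : ∀ n, L ⊓ 𝔞 ^ n • ⊤ ≤ 𝔞 ^ (n - d) • L ⊔ 𝔞 ^ (n + 1) • ⊤) :
    IsArtinReesBound 𝔞 d L := by
  have iterate (n k : ℕ) : L ⊓ 𝔞 ^ n • ⊤ ≤ 𝔞 ^ (n - d) • L ⊔ 𝔞 ^ (n + k) • ⊤ := by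
    induction k with
    | zero => exact inf_le_right.trans le_sup_right
    | succ k ih =>
      intro x hx
      obtain ⟨y, hy, z, hz, rfl⟩ := Submodule.mem_sup.1 (ih hx)
      have hzL : z ∈ L := (add_mem_cancel_left (Submodule.smul_le_right hy)).1 hx.1
      refine add_mem (Submodule.mem_sup_left hy) (SetLike.le_def.1 ?_ (h (n + k) ⟨hzL, hz⟩))
      exact sup_le_sup_right
        (Submodule.smul_mono_left (Ideal.pow_le_pow_right (by lia))) _
  exact fun n x hx => mem_of_forall_mem_sup_pow_smul h𝔞 fun k =>
    SetLike.le_def.1 (sup_le_sup_left (pow_smul_top_anti (by lia)) _) (iterate n k hx)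

lemma IsArtinReesBound.of_adicApprox (h𝔞 : 𝔞 ≤ (⊥ : Ideal R).jacobson)
    (hL : IsArtinReesBound 𝔞 d L) (h : L ≤ L' ⊔ 𝔞 ^ (d + 1) • ⊤) (h' : AdicApprox 𝔞 1 L' L) :
    IsArtinReesBound 𝔞 d L' := by
  refine .of_le_sup h𝔞 ?_
  rintro n x ⟨hx, hxn⟩
  obtain ⟨l, hl, e, he, rfl⟩ := Submodule.mem_sup.1 (h' n ⟨hx, hxn⟩)
  have hln : l ∈ (𝔞 ^ n • ⊤ : Submodule R E) :=
    (add_mem_cancel_right (pow_smul_top_anti n.le_succ he)).1 hxn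
  have hl' := smul_mono_right (𝔞 ^ (n - d)) h (hL n ⟨hl, hln⟩)
  rw [Submodule.smul_sup, ← Submodule.mul_smul, ← pow_add] at hl'
  exact add_mem (SetLike.le_def.1 (sup_le_sup_left (pow_smul_top_anti (by lia)) _) hl')
    (Submodule.mem_sup_right he)

lemma IsArtinReesBound.le_of_le_sup (h𝔞 : 𝔞 ≤ (⊥ : Ideal R).jacobson)
    (hL : IsArtinReesBound 𝔞 d L) (hle : L' ≤ L) (h : L ≤ L' ⊔ 𝔞 ^ (d + 1) • ⊤) : L ≤ L' := by
  refine Submodule.le_of_le_smul_of_le_jacobson_bot (IsNoetherian.noetherian L) h𝔞 ?_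
  calc L ≤ (L' ⊔ 𝔞 ^ (d + 1) • ⊤) ⊓ L := le_inf h le_rfl
    _ = L' ⊔ L ⊓ 𝔞 ^ (d + 1) • ⊤ := by rw [sup_inf_assoc_of_le _ hle, inf_comm]
    _ ≤ L' ⊔ 𝔞 • L := sup_le_sup_left ((hL (d + 1)).trans_eq (by simp)) _

theorem AdicClose.exists_range_eq_adicClose_ker [Module.Projective R F]
    (h𝔞 : 𝔞 ≤ (⊥ : Ideal R).jacobson) {φ : F →ₗ[R] E}
    (hφ : IsArtinReesBound 𝔞 d (LinearMap.range φ))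
    (h : AdicClose 𝔞 (c + d + 1) (LinearMap.range φ) L) :
    ∃ ψ : F →ₗ[R] E, LinearMap.range ψ = L ∧
      AdicClose 𝔞 (c + 1) (LinearMap.ker φ) (LinearMap.ker ψ) := by
  have hL : IsArtinReesBound 𝔞 d L :=
    hφ.of_adicApprox h𝔞 (h.1.mono (by lia)).le (h.2.mono (by lia))
  obtain ⟨ψ, hψL, hφψ⟩ := exists_range_le_of_range_le_sup φ h.1.le
  have hψφ : LinearMap.range (ψ - φ) ≤ 𝔞 ^ (c + d + 1) • ⊤ := by
    rwa [← neg_sub, LinearMap.range_neg]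
  have hφ_le : LinearMap.range φ ≤ LinearMap.range ψ ⊔ 𝔞 ^ (c + d + 1) • ⊤ := by
    rintro _ ⟨x, rfl⟩
    exact Submodule.mem_sup.2 ⟨ψ x, ⟨x, rfl⟩, _, hφψ ⟨x, rfl⟩, add_sub_cancel _ _⟩
  have hLψ : L ≤ LinearMap.range ψ := hL.le_of_le_sup h𝔞 hψL <|
    h.2.le.trans <| sup_le (hφ_le.trans (sup_le_sup_left (pow_smul_top_anti (by lia)) _))
      ((pow_smul_top_anti (by lia)).trans le_sup_right)
  obtain rfl : LinearMap.range ψ = L := le_antisymm hψL hLψ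
  rw [add_right_comm] at hφψ hψφ
  exact ⟨ψ, rfl, adicApprox_ker hL hφψ, adicApprox_ker hφ hψφ⟩

end AdicApproximation
section Splice

open Limits

variable {C : Type*} [Category* C] [Abelian C]

lemma quasiIso_toSingle₀Equiv_symm {K : ChainComplex C ℕ} {Z : C} (ε : K.X 0 ⟶ Z) [Epi ε]
    (w : K.d 1 0 ≫ ε = 0) (hε : (ShortComplex.mk _ _ w).Exact)
    (hK : ∀ n, K.ExactAt (n + 1)) :
    QuasiIso ((ChainComplex.toSingle₀Equiv K Z).symm ⟨ε, w⟩) := by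
  refine ⟨fun n => ?_⟩
  cases n with
  | zero =>
    rw [ChainComplex.quasiIsoAt₀_iff,
      ShortComplex.quasiIso_iff_of_zeros' _ (K.shape _ _ (by simp)) rfl rfl]
    refine (ShortComplex.exact_and_epi_g_iff_of_iso ?_).2 ⟨hε, ‹Epi ε›⟩
    refine ShortComplex.isoMk (Iso.refl _) (Iso.refl _) (Iso.refl _) ?_ ?_
    · exact (Category.id_comp _).trans (Category.comp_id _).symm
    · exact (Category.id_comp _).trans <|
        (ChainComplex.toSingle₀Equiv_symm_apply_f_zero ε w).symm.trans (Category.comp_id _).symm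
  | succ n =>
    rw [quasiIsoAt_iff_exactAt' _ _ (ChainComplex.exactAt_succ_single_obj _ _)]
    exact hK n

/-- The augmentation `P₀ ⟶ Z` of a projective resolution of `Z`: this is `P.π.f 0`, with `Z`
itself rather than the degree zero term of a complex as its target. -/
def augmentation {Z : C} (P : ProjectiveResolution Z) : P.complex.X 0 ⟶ Z :=
  (ChainComplex.toSingle₀Equiv P.complex Z P.π).1

lemma d_comp_augmentation {Z : C} (P : ProjectiveResolution Z) :
    P.complex.d 1 0 ≫ augmentation P = 0 :=
  (ChainComplex.toSingle₀Equiv P.complex Z P.π).2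

lemma augmentation_exact {Z : C} (P : ProjectiveResolution Z) :
    (ShortComplex.mk _ _ (d_comp_augmentation P)).Exact :=
  P.exact₀

instance {Z : C} (P : ProjectiveResolution Z) : Epi (augmentation P) :=
  inferInstanceAs (Epi (P.π.f 0))

lemma exact_comp_mono {X Y Z W : C} {f : X ⟶ Y} {g : Y ⟶ Z} (w : f ≫ g = 0)
    (h : (ShortComplex.mk f g w).Exact) (i : Z ⟶ W) [Mono i] :
    (ShortComplex.mk f (g ≫ i) (by rw [reassoc_of% w, zero_comp])).Exact := by
  let φ : ShortComplex.mk f g w ⟶ ShortComplex.mk f (g ≫ i) (by rw [reassoc_of% w, zero_comp]) :=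
    { τ₁ := 𝟙 _, τ₂ := 𝟙 _, τ₃ := i }
  exact (ShortComplex.exact_iff_of_epi_of_isIso_of_mono φ).1 h

lemma exact_epi_comp {W X Y Z : C} {f : X ⟶ Y} {g : Y ⟶ Z} (w : f ≫ g = 0)
    (h : (ShortComplex.mk f g w).Exact) (p : W ⟶ X) [Epi p] :
    (ShortComplex.mk (p ≫ f) g (by rw [Category.assoc, w, comp_zero])).Exact := by
  let φ : ShortComplex.mk (p ≫ f) g (by rw [Category.assoc, w, comp_zero]) ⟶
      ShortComplex.mk f g w :=
    { τ₁ := p, τ₂ := 𝟙 _, τ₃ := 𝟙 _ }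
  exact (ShortComplex.exact_iff_of_epi_of_isIso_of_mono φ).2 h

variable {S : ShortComplex C}

/-- A projective resolution of `S.X₁` extended by `S.X₂` in degree zero. -/
def spliceComplex (P : ProjectiveResolution S.X₁) : ChainComplex C ℕ :=
  P.complex.augment (augmentation P ≫ S.f)
    (by rw [← Category.assoc, d_comp_augmentation, zero_comp])

lemma spliceComplex_d_comp (P : ProjectiveResolution S.X₁) :
    (spliceComplex P).d 1 0 ≫ (S.g : (spliceComplex P).X 0 ⟶ S.X₃) = 0 := by
  change (augmentation P ≫ S.f) ≫ S.g = 0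
  rw [Category.assoc, S.zero, comp_zero]

lemma spliceComplex_exactAt_succ (P : ProjectiveResolution S.X₁) [Mono S.f] (n : ℕ) :
    (spliceComplex P).ExactAt (n + 1) := by
  rw [HomologicalComplex.exactAt_iff' _ (n + 2) (n + 1) n (by simp) (by simp)]
  cases n with
  | zero => exact exact_comp_mono _ (augmentation_exact P) S.f
  | succ n => exact P.exact_succ n

/-- The projective resolution of `S.X₃` obtained from one of `S.X₁` if `S` is short exact with
`S.X₂` projective. -/
def splice (hS : S.ShortExact) [Projective S.X₂] (P : ProjectiveResolution S.X₁) :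
    ProjectiveResolution S.X₃ where
  complex := spliceComplex P
  projective n := by
    cases n with
    | zero => exact inferInstanceAs (Projective S.X₂)
    | succ n => exact P.projective n
  π := (ChainComplex.toSingle₀Equiv (spliceComplex P) S.X₃).symm ⟨S.g, spliceComplex_d_comp P⟩
  quasiIso :=
    have := hS.mono_f
    have : @Epi C _ ((spliceComplex P).X 0) S.X₃ S.g := hS.epi_g
    quasiIso_toSingle₀Equiv_symm _ (spliceComplex_d_comp P)
      (exact_epi_comp _ hS.exact (augmentation P)) (spliceComplex_exactAt_succ P)

variable [HasProjectiveResolutions C] {D : Type*} [Category* D] [Abelian D] (F : C ⥤ D) [F.Additive]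

/-- Left derived functors as the homology of three consecutive terms of a complex. -/
def leftDerivedIsoHomologySc' {Z : C} (P : ProjectiveResolution Z) (i j k : ℕ)
    (hi : (ComplexShape.down ℕ).prev j = i) (hk : (ComplexShape.down ℕ).next j = k) :
    (F.leftDerived j).obj Z ≅
      (((F.mapHomologicalComplex _).obj P.complex).sc' i j k).homology :=
  P.isoLeftDerivedObj F j ≪≫
    ShortComplex.homologyMapIso (HomologicalComplex.isoSc' _ i j k hi hk)

/-- If the last map of a three term complex vanishes, its homology is a cokernel. -/
def homologyIsoCokernel (T : ShortComplex D) (hg : T.g = 0) : T.homology ≅ cokernel T.f :=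
  T.asIsoHomologyι hg ≪≫ T.opcyclesIsoCokernel

/-- Dimension shifting for left derived functors in degrees at least two. -/
def leftDerivedSuccSuccIso (hS : S.ShortExact) [Projective S.X₂] (n : ℕ) :
    (F.leftDerived (n + 2)).obj S.X₃ ≅ (F.leftDerived (n + 1)).obj S.X₁ :=
  let P := projectiveResolution S.X₁
  let e : (((F.mapHomologicalComplex _).obj (splice hS P).complex).sc' (n + 3) (n + 2)
      (n + 1)).homology ≅
      (((F.mapHomologicalComplex _).obj P.complex).sc' (n + 2) (n + 1) n).homology := Iso.refl _
  leftDerivedIsoHomologySc' F (splice hS P) (n + 3) (n + 2) (n + 1) (by simp) (by simp) ≪≫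
    e ≪≫ (leftDerivedIsoHomologySc' F P (n + 2) (n + 1) n (by simp) (by simp)).symm

/-- Dimension shifting for left derived functors in degree one, where it needs that the
functor kills the inclusion of the syzygy. -/
def leftDerivedOneIso (hS : S.ShortExact) [Projective S.X₂] (hF : F.map S.f = 0) :
    (F.leftDerived 1).obj S.X₃ ≅ (F.leftDerived 0).obj S.X₁ :=
  let P := projectiveResolution S.X₁
  let e₁ := homologyIsoCokernel
    (((F.mapHomologicalComplex _).obj (splice hS P).complex).sc' 2 1 0) (by
      change F.map (augmentation P ≫ S.f) = 0
      rw [F.map_comp, hF, comp_zero])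
  let e₂ := homologyIsoCokernel
    (((F.mapHomologicalComplex _).obj P.complex).sc' 1 0 0) (by
      change F.map (P.complex.d 0 0) = 0
      rw [P.complex.shape _ _ (by simp), F.map_zero])
  leftDerivedIsoHomologySc' F (splice hS P) 2 1 0 (by simp) (by simp) ≪≫ e₁ ≪≫
    e₂.symm ≪≫ (leftDerivedIsoHomologySc' F P 1 0 0 (by simp) (by simp)).symm

end Splice
section Betti

open scoped TensorProduct

variable {R : Type u} [CommRing R] [IsLocalRing R]
  {F M N : Type u} [AddCommGroup F] [Module R F] [AddCommGroup M] [Module R M]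
  [AddCommGroup N] [Module R N]

instance (M : Type u) [AddCommGroup M] [Module R M] (i : ℕ) :
    IsScalarTower R (ResidueField R) (TorModule R M (ResidueField R) i) :=
  Module.IsTorsionBySet.isScalarTower (I := maximalIdeal R) _

lemma finrank_residueField_eq_of_linearEquiv {V W : Type*} [AddCommGroup V] [AddCommGroup W]
    [Module R V] [Module R W] [Module (ResidueField R) V] [Module (ResidueField R) W]
    [IsScalarTower R (ResidueField R) V] [IsScalarTower R (ResidueField R) W] (e : V ≃ₗ[R] W) :
    Module.finrank (ResidueField R) V = Module.finrank (ResidueField R) W :=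
  (e.extendScalarsOfSurjective (residue_surjective (R := R))).finrank_eq

lemma bettiNumber_eq_of_iso {i j : ℕ}
    (e : TorModule R M (ResidueField R) i ≅ TorModule R N (ResidueField R) j) :
    bettiNumber R M i = bettiNumber R N j :=
  finrank_residueField_eq_of_linearEquiv e.toLinearEquiv

lemma bettiNumber_eq_of_linearEquiv (e : M ≃ₗ[R] N) (i : ℕ) :
    bettiNumber R M i = bettiNumber R N i :=
  bettiNumber_eq_of_iso (((Tor' (ModuleCat.{u} R) i).flip.obj
    (ModuleCat.of R (ResidueField R))).mapIso e.toModuleIso)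

lemma bettiNumber_zero (M : Type u) [AddCommGroup M] [Module R M] :
    bettiNumber R M 0 = Module.finrank (ResidueField R) (ResidueField R ⊗[R] M) := by
  let G := (MonoidalCategory.tensoringRight (ModuleCat.{u} R)).obj
    (ModuleCat.of R (ResidueField R))
  let e : TorModule R M (ResidueField R) 0 ≃ₗ[R] M ⊗[R] ResidueField R :=
    (G.leftDerivedZeroIsoSelf.app (ModuleCat.of R M)).toLinearEquiv
  exact finrank_residueField_eq_of_linearEquiv (e.trans (TensorProduct.comm R _ _))

lemma bettiNumber_zero_eq_zero_iff [Module.Finite R M] :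
    bettiNumber R M 0 = 0 ↔ Subsingleton M := by
  rw [bettiNumber_zero, Module.finrank_eq_zero_iff_of_free, subsingleton_tensorProduct]

lemma bettiNumber_one_eq_zero_of_projective [Module.Projective R M] : bettiNumber R M 1 = 0 := by
  have : Projective (ModuleCat.of R M) := (IsProjective.iff_projective M).1 ‹_›
  have : Subsingleton (TorModule R M (ResidueField R) 1) :=
    ModuleCat.isZero_iff_subsingleton.1 (isZero_Tor'_succ_of_projective _ _ _ 0)
  exact Module.finrank_zero_of_subsingleton

lemma rTensor_residueField_eq_zero {f : N →ₗ[R] F}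
    (hf : LinearMap.range f ≤ maximalIdeal R • ⊤) : f.rTensor (ResidueField R) = 0 := by
  refine TensorProduct.ext' fun y a => ?_
  rw [LinearMap.rTensor_tmul, LinearMap.zero_apply]
  refine Submodule.smul_induction_on (p := fun x => x ⊗ₜ[R] a = 0) (hf ⟨y, rfl⟩) ?_ ?_
  · intro r hr x _
    rw [TensorProduct.smul_tmul, Algebra.smul_def, ResidueField.algebraMap_eq,
      (residue_eq_zero_iff _).2 hr, zero_mul, TensorProduct.tmul_zero]
  · intro x y hx hy
    rw [TensorProduct.add_tmul, hx, hy, add_zero]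

/-- `φ : F → M` is a minimal cover: it is surjective with kernel contained in `𝔪F`. For `F` free
this is the first step of the minimal free resolution of `M`. -/
structure IsMinimalCover (φ : F →ₗ[R] M) : Prop where
  surjective : Function.Surjective φ
  ker_le : LinearMap.ker φ ≤ maximalIdeal R • ⊤

namespace IsMinimalCover

variable {φ : F →ₗ[R] M}

lemma rTensor_subtype_ker (hφ : IsMinimalCover φ) :
    (LinearMap.ker φ).subtype.rTensor (ResidueField R) = 0 :=
  rTensor_residueField_eq_zero ((Submodule.range_subtype _).trans_le hφ.ker_le)

lemma rTensor_bijective (hφ : IsMinimalCover φ) :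
    Function.Bijective (φ.rTensor (ResidueField R)) := by
  refine ⟨?_, LinearMap.rTensor_surjective _ hφ.surjective⟩
  rw [← LinearMap.ker_eq_bot, (rTensor_exact (ResidueField R)
    (LinearMap.exact_subtype_ker_map φ) hφ.surjective).linearMap_ker_eq, hφ.rTensor_subtype_ker,
    LinearMap.range_zero]

theorem bettiNumber_zero [Module.Free R F] (hφ : IsMinimalCover φ) :
    bettiNumber R M 0 = Module.finrank R F := by
  let e := LinearEquiv.ofBijective _ hφ.rTensor_bijective
  rw [BettiPerturbation.bettiNumber_zero,
    ← Module.finrank_baseChange (R := ResidueField R) (M' := F)]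
  exact finrank_residueField_eq_of_linearEquiv
    (TensorProduct.comm R _ _ ≪≫ₗ e.symm ≪≫ₗ TensorProduct.comm R _ _)

theorem bettiNumber_succ [Module.Projective R F] (hφ : IsMinimalCover φ) (i : ℕ) :
    bettiNumber R M (i + 1) = bettiNumber R (LinearMap.ker φ) i := by
  let G := (MonoidalCategory.tensoringRight (ModuleCat.{u} R)).obj
    (ModuleCat.of R (ResidueField R))
  have hS := LinearMap.shortExact_shortComplexKer hφ.surjective
  have : Projective φ.shortComplexKer.X₂ := inferInstanceAs (Projective (ModuleCat.of R F))
  cases i with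
  | zero =>
    have hG : G.map φ.shortComplexKer.f = 0 := ModuleCat.hom_ext hφ.rTensor_subtype_ker
    exact bettiNumber_eq_of_iso (leftDerivedOneIso G hS hG)
  | succ i => exact bettiNumber_eq_of_iso (leftDerivedSuccSuccIso G hS i)

end IsMinimalCover

/-- A basis of `k ⊗ M` lifts to a minimal system of generators, by Nakayama's lemma. -/
theorem exists_isMinimalCover (R : Type u) [CommRing R] [IsLocalRing R] (M : Type u)
    [AddCommGroup M] [Module R M] [Module.Finite R M] :
    ∃ (n : ℕ) (φ : (Fin n → R) →ₗ[R] M), IsMinimalCover φ := by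
  let b := Module.finBasis (ResidueField R) (ResidueField R ⊗[R] M)
  obtain ⟨v, hv⟩ := (TensorProduct.mk_surjective R M (ResidueField R)
    (residue_surjective (R := R))).comp_left b
  refine ⟨_, Fintype.linearCombination R v, ?_, fun a ha => ?_⟩
  · rw [← LinearMap.range_eq_top, Fintype.range_linearCombination]
    exact span_eq_top_of_tmul_eq_basis v b (congr_fun hv)
  · have hsum : ∑ i, residue R (a i) • b i = 0 :=
      calc ∑ i, residue R (a i) • b i
          = TensorProduct.mk R (ResidueField R) M 1 (Fintype.linearCombination R v a) := by
            rw [Fintype.linearCombination_apply, map_sum]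
            refine Finset.sum_congr rfl fun i _ => ?_
            rw [map_smul, ← congr_fun hv i]
            exact algebraMap_smul (ResidueField R) (a i) _
        _ = 0 := by rw [LinearMap.mem_ker.1 ha, map_zero]
    have ha_mem (i) : a i ∈ maximalIdeal R :=
      (residue_eq_zero_iff _).1 (Fintype.linearIndependent_iff.1 b.linearIndependent _ hsum i)
    rw [pi_eq_sum_univ' a]
    exact sum_mem fun i _ => Submodule.smul_mem_smul (ha_mem i) trivial

variable [IsNoetherianRing R]

lemma IsMinimalCover.hasProjectiveDimensionLT_succ_iff [Module.Projective R F] [Module.Finite R F]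
    {φ : F →ₗ[R] M} (hφ : IsMinimalCover φ) (n : ℕ) :
    HasProjectiveDimensionLT (ModuleCat.of R M) (n + 1) ↔
      HasProjectiveDimensionLT (ModuleCat.of R (LinearMap.ker φ)) n := by
  have hS := LinearMap.shortExact_shortComplexKer hφ.surjective
  have hP : Projective φ.shortComplexKer.X₂ := inferInstanceAs (Projective (ModuleCat.of R F))
  cases n with
  | zero =>
    refine ⟨fun h => ?_, fun h => hS.hasProjectiveDimensionLT_X₃ 0 h inferInstance⟩
    have : Module.Projective R M :=
      (IsProjective.iff_projective M).2 (projective_iff_hasProjectiveDimensionLT_one.2 h)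
    have hker : bettiNumber R (LinearMap.ker φ) 0 = 0 := by
      rw [← hφ.bettiNumber_succ, bettiNumber_one_eq_zero_of_projective]
    rw [hasProjectiveDimensionLT_zero_iff_isZero, ModuleCat.isZero_iff_subsingleton]
    exact bettiNumber_zero_eq_zero_iff.1 hker
  | succ n => exact hS.hasProjectiveDimensionLT_X₃_iff n hP

theorem hasProjectiveDimensionLT_iff_bettiNumber_eq_zero (n : ℕ) (M : Type u) [AddCommGroup M]
    [Module R M] [Module.Finite R M] :
    HasProjectiveDimensionLT (ModuleCat.of R M) n ↔ bettiNumber R M n = 0 := by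
  induction n generalizing M with
  | zero =>
    rw [hasProjectiveDimensionLT_zero_iff_isZero, ModuleCat.isZero_iff_subsingleton]
    exact bettiNumber_zero_eq_zero_iff.symm
  | succ n ih =>
    obtain ⟨r, φ, hφ⟩ := exists_isMinimalCover R M
    rw [hφ.hasProjectiveDimensionLT_succ_iff, hφ.bettiNumber_succ, ih]

end Betti

section AuslanderBuchsbaum

open Abelian

variable {R : Type u} [CommRing R] {F E : Type u} [AddCommGroup F] [Module R F]
  [AddCommGroup E] [Module R E]

lemma ext_comp_mk₀_eq_sum {ι : Type*} [Fintype ι] (b : Module.Basis ι R F) (f : F →ₗ[R] E)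
    {X : ModuleCat.{u} R} {i : ℕ} (x : Ext X (ModuleCat.of R F) i) :
    x.comp (Ext.mk₀ (ModuleCat.ofHom f)) (add_zero i) =
      ∑ j, (x.comp (Ext.mk₀ (ModuleCat.ofHom (b.coord j))) (add_zero i)).comp
        (Ext.mk₀ (ModuleCat.ofHom (LinearMap.toSpanSingleton R E (f (b j))))) (add_zero i) := by
  have hf : ModuleCat.ofHom f = ∑ j, ModuleCat.ofHom (b.coord j) ≫
      ModuleCat.ofHom (LinearMap.toSpanSingleton R E (f (b j))) := by
    classical
    refine ModuleCat.hom_ext (b.ext fun j => ?_)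
    simp [ModuleCat.hom_sum, Finsupp.single_apply]
  simp only [hf, Ext.mk₀_sum, Ext.comp_sum, Ext.comp_assoc_of_third_deg_zero, Ext.mk₀_comp_mk₀]

lemma subsingleton_ext_of_finite_free [Module.Free R F] [Module.Finite R F]
    {X : ModuleCat.{u} R} {i : ℕ} [Subsingleton (Ext X (ModuleCat.of R R) i)] :
    Subsingleton (Ext X (ModuleCat.of R F) i) := by
  refine subsingleton_of_forall_eq 0 fun x => ?_
  rw [← x.comp_mk₀_id, ← ModuleCat.ofHom_id,
    ext_comp_mk₀_eq_sum (Module.Free.chooseBasis R F)]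
  refine Finset.sum_eq_zero fun j _ => ?_
  rw [Subsingleton.elim (x.comp _ _) 0, Ext.zero_comp]

lemma nontrivial_ext_of_free [Module.Free R F] [Nontrivial F]
    {X : ModuleCat.{u} R} {i : ℕ} [Nontrivial (Ext X (ModuleCat.of R R) i)] :
    Nontrivial (Ext X (ModuleCat.of R F) i) := by
  let b := Module.Free.chooseBasis R F
  obtain ⟨j⟩ := b.index_nonempty
  have h_retract : ModuleCat.ofHom (LinearMap.toSpanSingleton R F (b j)) ≫
      ModuleCat.ofHom (b.coord j) = 𝟙 _ := by
    ext
    simp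
  obtain ⟨x, hx⟩ := exists_ne (0 : Ext X (ModuleCat.of R R) i)
  refine nontrivial_of_ne
    (x.comp (Ext.mk₀ (ModuleCat.ofHom (LinearMap.toSpanSingleton R F (b j)))) (add_zero i)) 0
    fun h => hx ?_
  rw [← x.comp_mk₀_id, ← h_retract, ← Ext.mk₀_comp_mk₀, ← Ext.comp_assoc_of_third_deg_zero, h,
    Ext.zero_comp]

/-- By the long exact sequence, a class that dies in the middle term is a connecting image. -/
lemma exists_nontrivial_ext_of_comp_mk₀_eq_zero {S : ShortComplex (ModuleCat.{u} R)}
    (hS : S.ShortExact) {X : ModuleCat.{u} R} {i : ℕ} {x : Ext X S.X₁ i} (hx : x ≠ 0)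
    (hx' : x.comp (Ext.mk₀ S.f) (add_zero i) = 0) :
    ∃ j, j + 1 = i ∧ Nontrivial (Ext X S.X₃ j) := by
  cases i with
  | zero =>
    have := hS.mono_f
    exact absurd ((injective_iff_map_eq_zero ((Ext.mk₀ S.f).postcomp X (add_zero 0))).1
      (Ext.postcomp_mk₀_injective_of_mono X S.f) x hx') hx
  | succ j =>
    obtain ⟨y, rfl⟩ := Ext.covariant_sequence_exact₁ X hS x hx' rfl
    refine ⟨j, rfl, nontrivial_of_ne y 0 ?_⟩
    rintro rfl
    exact hx (Ext.zero_comp _ _ _ _ _)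

variable [IsLocalRing R]

lemma smul_ext_residueField_eq_zero {r : R} (hr : r ∈ maximalIdeal R) {Y : ModuleCat.{u} R}
    {i : ℕ} (x : Ext (ModuleCat.of R (ResidueField R)) Y i) : r • x = 0 := by
  have hid : r • 𝟙 (ModuleCat.of R (ResidueField R)) = 0 := by
    ext y
    change r • y = 0
    rw [Algebra.smul_def, ResidueField.algebraMap_eq, (residue_eq_zero_iff _).2 hr, zero_mul]
  rw [← x.mk₀_id_comp, ← Ext.smul_comp, ← Ext.mk₀_smul, hid, Ext.mk₀_zero, Ext.zero_comp]

lemma ext_residueField_comp_mk₀_eq_zero [Module.Free R F] [Module.Finite R F] {f : F →ₗ[R] E}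
    (hf : LinearMap.range f ≤ maximalIdeal R • ⊤) {i : ℕ}
    (x : Ext (ModuleCat.of R (ResidueField R)) (ModuleCat.of R F) i) :
    x.comp (Ext.mk₀ (ModuleCat.ofHom f)) (add_zero i) = 0 := by
  have hsmul (y : Ext (ModuleCat.of R (ResidueField R)) (ModuleCat.of R R) i) {e : E}
      (he : e ∈ (maximalIdeal R • ⊤ : Submodule R E)) :
      y.comp (Ext.mk₀ (ModuleCat.ofHom (LinearMap.toSpanSingleton R E e))) (add_zero i) = 0 := by
    induction he using Submodule.smul_induction_on' with
    | smul r hr e _ =>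
      rw [LinearMap.toSpanSingleton_smul]
      exact (congrArg (y.comp · _) (Ext.mk₀_smul r _)).trans
        ((Ext.comp_smul _ _ _ r).trans (smul_ext_residueField_eq_zero hr _))
    | add e _ e' _ he he' =>
      rw [LinearMap.toSpanSingleton_add, ModuleCat.ofHom_add, Ext.mk₀_add, Ext.comp_add, he, he',
        add_zero]
  rw [ext_comp_mk₀_eq_sum (Module.Free.chooseBasis R F)]
  exact Finset.sum_eq_zero fun j _ => hsmul _ (hf ⟨_, rfl⟩)

theorem exists_nontrivial_ext_residueField (R : Type u) [CommRing R] [IsLocalRing R]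
    [IsNoetherianRing R] :
    ∃ i, Nontrivial (Ext (ModuleCat.of R (ResidueField R)) (ModuleCat.of R R) i) := by
  by_contra! h
  have hlt : maximalIdeal R • (⊤ : Submodule R R) < ⊤ := by
    rw [smul_eq_mul, Ideal.mul_top]
    exact (Ideal.IsPrime.ne_top inferInstance).lt_top
  have hsupp : Module.support R (ResidueField R) = PrimeSpectrum.zeroLocus (maximalIdeal R) := by
    rw [Module.support_eq_zeroLocus]
    congr 1
    exact congrArg _ (Ideal.annihilator_quotient (I := maximalIdeal R))
  obtain ⟨d, hd⟩ : ∃ d : ℕ, ringKrullDim R = d :=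
    ⟨_, Order.krullDim_eq_length_of_finiteDimensionalOrder⟩
  obtain ⟨rs, hlen, -, hrs⟩ := ModuleCat.exists_isRegular_of_exists_subsingleton_ext
    (maximalIdeal R) (d + 1) (ModuleCat.of R R) hlt (ModuleCat.of R (ResidueField R)) hsupp
    fun i _ => h i
  have hdim := ringKrullDim_add_length_eq_ringKrullDim_of_isRegular rs hrs
  have : Nontrivial (R ⧸ Ideal.ofList rs) := by
    rw [Ideal.Quotient.nontrivial_iff]
    simpa only [smul_eq_mul, Ideal.mul_top] using hrs.top_ne_smul.symm
  have hle : ((d + 1 : ℕ) : WithBot ℕ∞) ≤ d := by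
    rw [← hd, ← hdim, hlen]
    exact le_add_of_nonneg_left ringKrullDim_nonneg_of_nontrivial
  exact absurd hle (by norm_cast; lia)

lemma free_of_hasProjectiveDimensionLT_one [Module.Finite R F]
    (h : HasProjectiveDimensionLT (ModuleCat.of R F) 1) : Module.Free R F := by
  have : Module.Projective R F :=
    (IsProjective.iff_projective F).2 (projective_iff_hasProjectiveDimensionLT_one.2 h)
  exact Module.free_of_flat_of_isLocalRing

variable [IsNoetherianRing R]

/-- For the depth `t` of `R`, measured by `Ext(k, R)`, this is the inequality `pd M ≤ t` of the
**Auslander–Buchsbaum formula** together with the nonvanishing of `Ext^{t - pd M}(k, M)`. -/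
theorem exists_nontrivial_ext_of_projectiveDimension_eq {t : ℕ}
    (ht : Nontrivial (Ext (ModuleCat.of R (ResidueField R)) (ModuleCat.of R R) t))
    (ht_min : ∀ i < t, Subsingleton (Ext (ModuleCat.of R (ResidueField R)) (ModuleCat.of R R) i))
    (n : ℕ) (M : Type u) [AddCommGroup M] [Module R M] [Module.Finite R M]
    (h : HasProjectiveDimensionLT (ModuleCat.of R M) (n + 1))
    (h' : ¬ HasProjectiveDimensionLT (ModuleCat.of R M) n) :
    ∃ j, j + n = t ∧ Nontrivial (Ext (ModuleCat.of R (ResidueField R)) (ModuleCat.of R M) j) := by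
  induction n generalizing M with
  | zero =>
    have := free_of_hasProjectiveDimensionLT_one h
    have : Nontrivial M := by
      rwa [hasProjectiveDimensionLT_zero_iff_isZero, ModuleCat.isZero_iff_subsingleton,
        not_subsingleton_iff_nontrivial] at h'
    exact ⟨t, rfl, nontrivial_ext_of_free⟩
  | succ n ih =>
    obtain ⟨r, φ, hφ⟩ := exists_isMinimalCover R M
    rw [hφ.hasProjectiveDimensionLT_succ_iff] at h h'
    obtain ⟨j, rfl, hj⟩ := ih (LinearMap.ker φ) h h'
    obtain ⟨x, hx⟩ := exists_ne
      (0 : Ext (ModuleCat.of R (ResidueField R)) (ModuleCat.of R (LinearMap.ker φ)) j)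
    have hS := LinearMap.shortExact_shortComplexKer hφ.surjective
    -- Either the syzygy is free and contained in `𝔪F`, or `j < t` and `Ext^j(k, F) = 0`.
    have hx_comp : x.comp (Ext.mk₀ φ.shortComplexKer.f) (add_zero j) = 0 := by
      cases n with
      | zero =>
        have := free_of_hasProjectiveDimensionLT_one h
        exact ext_residueField_comp_mk₀_eq_zero
          ((Submodule.range_subtype _).trans_le hφ.ker_le) x
      | succ n =>
        have := ht_min j (by lia)
        have := subsingleton_ext_of_finite_free (F := Fin r → R)
          (X := ModuleCat.of R (ResidueField R)) (i := j)
        exact Subsingleton.elim (α := Ext _ (ModuleCat.of R (Fin r → R)) j) _ _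
    obtain ⟨i, rfl, hi⟩ := exists_nontrivial_ext_of_comp_mk₀_eq_zero hS hx hx_comp
    exact ⟨i, by lia, hi⟩

theorem exists_hasProjectiveDimensionLT_bound (R : Type u) [CommRing R] [IsLocalRing R]
    [IsNoetherianRing R] :
    ∃ b, ∀ (M : Type u) [AddCommGroup M] [Module R M] [Module.Finite R M] (n : ℕ),
      HasProjectiveDimensionLT (ModuleCat.of R M) n →
        HasProjectiveDimensionLT (ModuleCat.of R M) b := by
  classical
  have hex := exists_nontrivial_ext_residueField R
  refine ⟨Nat.find hex + 1, fun M _ _ _ n hn => ?_⟩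
  induction n with
  | zero => exact hasProjectiveDimensionLT_of_ge _ 0 _ (Nat.zero_le _)
  | succ n ih =>
    by_cases hM : HasProjectiveDimensionLT (ModuleCat.of R M) n
    · exact ih hM
    obtain ⟨j, hj, -⟩ := exists_nontrivial_ext_of_projectiveDimension_eq (Nat.find_spec hex)
      (fun i hi => not_nontrivial_iff_subsingleton.1 (Nat.find_min hex hi)) n M hn hM
    exact hasProjectiveDimensionLT_of_ge _ (n + 1) _ (by lia)

theorem exists_projectiveDimension_eq_of_bettiNumber_eq (R : Type u) [CommRing R]
    [IsLocalRing R] [IsNoetherianRing R] :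
    ∃ b, ∀ (M N : Type u) [AddCommGroup M] [Module R M] [Module.Finite R M] [AddCommGroup N]
      [Module R N] [Module.Finite R N], (∀ i ≤ b, bettiNumber R M i = bettiNumber R N i) →
        projectiveDimension (ModuleCat.of R M) = projectiveDimension (ModuleCat.of R N) := by
  obtain ⟨b, hb⟩ := exists_hasProjectiveDimensionLT_bound R
  have hasProjectiveDimensionLT_iff (n : ℕ) (M : Type u) [AddCommGroup M] [Module R M]
      [Module.Finite R M] :
      HasProjectiveDimensionLT (ModuleCat.of R M) n ↔ bettiNumber R M (min n b) = 0 := by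
    rw [← hasProjectiveDimensionLT_iff_bettiNumber_eq_zero]
    refine ⟨fun h => ?_, fun h => hasProjectiveDimensionLT_of_ge _ _ n (min_le_left n b)⟩
    rcases min_choice n b with hmin | hmin <;> rw [hmin]
    exacts [h, hb M n h]
  refine ⟨b, fun M N _ _ _ _ _ _ h => ?_⟩
  simp only [projectiveDimension, hasProjectiveDimensionLT_iff, h _ (min_le_right _ b)]

end AuslanderBuchsbaum

section Perturbation

variable {R : Type u} [CommRing R] {E F G : Type u} [AddCommGroup E] [Module R E]
  [AddCommGroup F] [Module R F] [AddCommGroup G] [Module R G] {L L' : Submodule R E}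
  {φ : F →ₗ[R] E}

lemma ker_mkQ_comp (φ : F →ₗ[R] E) (L : Submodule R E) :
    LinearMap.ker (L.mkQ ∘ₗ φ) = L.comap φ := by
  rw [LinearMap.ker_comp, Submodule.ker_mkQ]

variable [IsLocalRing R]

lemma IsMinimalCover.range_sup_eq_top (h : IsMinimalCover (L.mkQ ∘ₗ φ)) :
    LinearMap.range φ ⊔ L = ⊤ := by
  simpa only [LinearMap.range_comp, Submodule.comap_map_mkQ, sup_comm, Submodule.comap_top]
    using congrArg (Submodule.comap L.mkQ) (LinearMap.range_eq_top.2 h.surjective)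

lemma IsMinimalCover.of_adicClose [Module.Finite R E] (h : IsMinimalCover (L.mkQ ∘ₗ φ))
    (hL : AdicClose (maximalIdeal R) 1 L L') :
    IsMinimalCover (L'.mkQ ∘ₗ φ) := by
  have h_top : LinearMap.range φ ⊔ L' = ⊤ := by
    refine top_le_iff.1 (Submodule.le_of_le_smul_of_le_jacobson_bot Module.Finite.fg_top
      (maximalIdeal_le_jacobson _) ?_)
    calc ⊤ = LinearMap.range φ ⊔ L := h.range_sup_eq_top.symm
      _ ≤ LinearMap.range φ ⊔ (L' ⊔ maximalIdeal R • ⊤) :=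
        sup_le_sup_left (by simpa only [pow_one] using hL.1.le) _
      _ = LinearMap.range φ ⊔ L' ⊔ maximalIdeal R • ⊤ := (sup_assoc _ _ _).symm
  refine ⟨?_, ?_⟩
  · rw [← LinearMap.range_eq_top, LinearMap.range_comp, ← bot_sup_eq (Submodule.map _ _),
      ← L'.mkQ_map_self, ← Submodule.map_sup, sup_comm, h_top, Submodule.map_top,
      Submodule.range_mkQ]
  · have hker := (hL.2.comap φ h.range_sup_eq_top).le
    rw [pow_one] at hker
    rw [ker_mkQ_comp]
    exact hker.trans (sup_le (ker_mkQ_comp φ L ▸ h.ker_le) le_rfl)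

lemma IsMinimalCover.bettiNumber_succ_eq_of_range_eq [Module.Projective R F]
    (h : IsMinimalCover (L.mkQ ∘ₗ φ)) {π : G →ₗ[R] F} (hπ : LinearMap.range π = L.comap φ)
    (i : ℕ) : bettiNumber R (E ⧸ L) (i + 1) = bettiNumber R (G ⧸ LinearMap.ker π) i := by
  rw [h.bettiNumber_succ]
  exact bettiNumber_eq_of_linearEquiv (π.quotKerEquivRange.trans
    (LinearEquiv.ofEq _ _ (hπ.trans (ker_mkQ_comp φ L).symm))).symm i

lemma exists_isMinimalCover_mkQ_comp [Module.Finite R E] (L : Submodule R E) :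
    ∃ (n : ℕ) (φ : (Fin n → R) →ₗ[R] E), IsMinimalCover (L.mkQ ∘ₗ φ) := by
  obtain ⟨n, φ, hφ⟩ := exists_isMinimalCover R (E ⧸ L)
  obtain ⟨φ', rfl⟩ := Module.projective_lifting_property L.mkQ φ L.mkQ_surjective
  exact ⟨n, φ', hφ⟩

variable [IsNoetherianRing R]

/-- The relations of a minimal cover of `E ⧸ L`, and then a presentation `π` of these relations,
are perturbed along with `L`; passing from `E ⧸ L` to the quotient by `ker π` lowers the index. -/
theorem exists_adicClose_imp_bettiNumber_eq (p : ℕ) {E : Type u} [AddCommGroup E] [Module R E]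
    [Module.Finite R E] (L : Submodule R E) :
    ∃ c, ∀ L' : Submodule R E, AdicClose (maximalIdeal R) c L L' →
      ∀ i ≤ p, bettiNumber R (E ⧸ L) i = bettiNumber R (E ⧸ L') i := by
  induction p generalizing E with
  | zero =>
    obtain ⟨r, φ, hφ⟩ := exists_isMinimalCover_mkQ_comp L
    refine ⟨1, fun L' h i hi => ?_⟩
    rw [Nat.le_zero.1 hi, hφ.bettiNumber_zero, (hφ.of_adicClose h).bettiNumber_zero]
  | succ p ih =>
    obtain ⟨r, φ, hφ⟩ := exists_isMinimalCover_mkQ_comp L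
    obtain ⟨s, π, hπ⟩ : ∃ (s : ℕ) (π : (Fin s → R) →ₗ[R] (Fin r → R)),
        LinearMap.range π = L.comap φ := by
      obtain ⟨s, π, hπ⟩ := Module.Finite.exists_fin' R (L.comap φ)
      refine ⟨s, (L.comap φ).subtype ∘ₗ π, ?_⟩
      rw [LinearMap.range_comp_of_range_eq_top _ (LinearMap.range_eq_top.2 hπ),
        Submodule.range_subtype]
    obtain ⟨d, hd⟩ := exists_isArtinReesBound (maximalIdeal R) (LinearMap.range π)
    obtain ⟨c, hc⟩ := ih (LinearMap.ker π)
    refine ⟨c + d + 1, fun L' h i hi => ?_⟩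
    have hφ' : IsMinimalCover (L'.mkQ ∘ₗ φ) := hφ.of_adicClose (h.mono (by lia))
    have h_comap := h.comap φ hφ.range_sup_eq_top hφ'.range_sup_eq_top
    rw [← hπ] at h_comap
    obtain ⟨ψ, hψ, h_ker⟩ :=
      h_comap.exists_range_eq_adicClose_ker (maximalIdeal_le_jacobson _) hd
    cases i with
    | zero => rw [hφ.bettiNumber_zero, hφ'.bettiNumber_zero]
    | succ i =>
      rw [hφ.bettiNumber_succ_eq_of_range_eq hπ, hφ'.bettiNumber_succ_eq_of_range_eq hψ]
      exact hc _ (h_ker.mono c.le_succ) i (by lia)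

end Perturbation

section HilbertFunction

variable {R : Type u} [CommRing R] [IsLocalRing R] {E : Type u} [AddCommGroup E] [Module R E]
  {L L' : Submodule R E}

instance (M : Type u) [AddCommGroup M] [Module R M] (n : ℕ) :
    IsScalarTower R (ResidueField R) (GradedPiece R M n) :=
  inferInstanceAs (IsScalarTower R (R ⧸ maximalIdeal R) (GradedPiece R M n))

variable (R) in
/-- The Hilbert function `n ↦ dim_k (𝔪ⁿM / 𝔪ⁿ⁺¹M)` of a finitely generated module `M` over a
Noetherian local ring, generalizing `hilbertFunction` from cyclic modules. -/
def moduleHilbertFunction (M : Type u) [AddCommGroup M] [Module R M] (n : ℕ) : ℕ :=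
  Module.finrank (ResidueField R) (GradedPiece R M n)

lemma hilbertFunction_eq_moduleHilbertFunction (I : Ideal R) :
    hilbertFunction I = moduleHilbertFunction R (R ⧸ I) :=
  rfl

/-- The degree `n` component `𝔪ⁿE → gr_𝔪(E ⧸ L)` of the map of associated graded modules induced
by `E → E ⧸ L`, precomposed with `𝔪ⁿE → gr_𝔪(E)`. Its kernel encodes the initial forms of `L`. -/
def toGradedPiece (L : Submodule R E) (n : ℕ) :
    (maximalIdeal R ^ n • ⊤ : Submodule R E) →ₗ[R] GradedPiece R (E ⧸ L) n :=
  Submodule.mkQ _ ∘ₗ L.mkQ.restrict (Submodule.smul_top_le_comap_smul_top _ L.mkQ)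

lemma toGradedPiece_surjective (L : Submodule R E) (n : ℕ) :
    Function.Surjective (toGradedPiece L n) := by
  refine (Submodule.mkQ_surjective _).comp ?_
  rintro ⟨y, hy⟩
  rw [← L.range_mkQ, ← Submodule.map_top, ← Submodule.map_smul''] at hy
  obtain ⟨x, hx, rfl⟩ := hy
  exact ⟨⟨x, hx⟩, rfl⟩

lemma ker_toGradedPiece (L : Submodule R E) (n : ℕ) :
    LinearMap.ker (toGradedPiece L n) =
      (L ⊔ maximalIdeal R ^ (n + 1) • ⊤).comap (Submodule.subtype _) := by
  let Q := (maximalIdeal R ^ n • ⊤ : Submodule R (E ⧸ L))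
  have hQ : (maximalIdeal R • ⊤ : Submodule R Q) =
      (maximalIdeal R ^ (n + 1) • ⊤ : Submodule R (E ⧸ L)).comap Q.subtype := by
    rw [← Submodule.comap_map_eq_of_injective Q.injective_subtype (_ • ⊤), Submodule.map_smul'',
      Submodule.map_top, Submodule.range_subtype, pow_succ', Submodule.mul_smul]
  rw [← Submodule.comap_map_mkQ, Submodule.map_smul'', Submodule.map_top, Submodule.range_mkQ,
    toGradedPiece, LinearMap.ker_comp, Submodule.ker_mkQ, hQ]
  rfl

lemma adicApprox_one_iff_ker_toGradedPiece_le :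
    AdicApprox (maximalIdeal R) 1 L L' ↔
      ∀ n, LinearMap.ker (toGradedPiece L n) ≤ LinearMap.ker (toGradedPiece L' n) := by
  simp only [ker_toGradedPiece]
  refine forall_congr' fun n => ⟨?_, fun h x hx => ?_⟩
  · rintro h ⟨x, hxn⟩ hx
    obtain ⟨y, hy, z, hz, rfl⟩ := Submodule.mem_sup.1 hx
    have hyn := (add_mem_cancel_right (pow_smul_top_anti n.le_succ hz)).1 hxn
    exact add_mem (h ⟨hy, hyn⟩) (Submodule.mem_sup_right hz)
  · exact h (x := ⟨x, hx.2⟩) (Submodule.mem_sup_left hx.1)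

lemma ker_eq_of_ker_le_of_finrank_eq {A B : Type*} [AddCommGroup A] [Module R A]
    [Module (ResidueField R) A] [IsScalarTower R (ResidueField R) A] [AddCommGroup B]
    [Module R B] [Module (ResidueField R) B] [IsScalarTower R (ResidueField R) B]
    [Module.Finite R A] [Module.Finite R B] {f : E →ₗ[R] A} {g : E →ₗ[R] B}
    (hf : Function.Surjective f) (hg : Function.Surjective g)
    (hfg : LinearMap.ker f ≤ LinearMap.ker g)
    (h : Module.finrank (ResidueField R) A = Module.finrank (ResidueField R) B) :
    LinearMap.ker f = LinearMap.ker g := by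
  have : Module.Finite (ResidueField R) A := Module.Finite.of_restrictScalars_finite R _ _
  have : Module.Finite (ResidueField R) B := Module.Finite.of_restrictScalars_finite R _ _
  let u : A →ₗ[R] B := (LinearMap.ker f).liftQ g hfg ∘ₗ (f.quotKerEquivOfSurjective hf).symm
  have huf : u ∘ₗ f = g := by
    ext x
    simp [u]
  have hu : Function.Surjective u :=
    Function.Surjective.of_comp (g := f) (by rwa [← LinearMap.coe_comp, huf])
  have hu' : Function.Injective u := (LinearMap.injective_iff_surjective_of_finrank_eq_finrank
    (f := u.extendScalarsOfSurjective (residue_surjective (R := R))) h).2 hu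
  rw [← huf, LinearMap.ker_comp_of_ker_eq_bot _ (LinearMap.ker_eq_bot.2 hu')]

variable [IsNoetherianRing R] [Module.Finite R E]

/-- A surjection of graded modules with the same Hilbert function is an isomorphism. -/
theorem AdicApprox.symm_of_moduleHilbertFunction_eq (h : AdicApprox (maximalIdeal R) 1 L L')
    (hL : moduleHilbertFunction R (E ⧸ L) = moduleHilbertFunction R (E ⧸ L')) :
    AdicApprox (maximalIdeal R) 1 L' L := by
  rw [adicApprox_one_iff_ker_toGradedPiece_le] at h ⊢
  exact fun n => (ker_eq_of_ker_le_of_finrank_eq (toGradedPiece_surjective L n)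
    (toGradedPiece_surjective L' n) (h n) (congrFun hL n)).ge

theorem exists_adicClose_of_moduleHilbertFunction_eq (L : Submodule R E) (c : ℕ) :
    ∃ N₀, ∀ N ≥ N₀, ∀ L' : Submodule R E,
      L' ⊔ maximalIdeal R ^ N • ⊤ = L ⊔ maximalIdeal R ^ N • ⊤ →
      moduleHilbertFunction R (E ⧸ L') = moduleHilbertFunction R (E ⧸ L) →
      AdicClose (maximalIdeal R) c L L' := by
  obtain ⟨d, hd⟩ := exists_isArtinReesBound (maximalIdeal R) L
  refine ⟨c + 1 + d, fun N hN L' hL hH => ?_⟩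
  have hLL' : L ≤ L' ⊔ maximalIdeal R ^ (c + 1 + d) • ⊤ :=
    (le_sup_left.trans hL.ge).trans (sup_le_sup_left (pow_smul_top_anti hN) _)
  have hL'L : L' ≤ L ⊔ maximalIdeal R ^ (c + 1 + d) • ⊤ :=
    (le_sup_left.trans hL.le).trans (sup_le_sup_left (pow_smul_top_anti hN) _)
  have happrox : AdicApprox (maximalIdeal R) (c + 1) L L' := hd.adicApprox hLL'
  have hd' : IsArtinReesBound (maximalIdeal R) d L' :=
    hd.of_adicApprox (maximalIdeal_le_jacobson _)
      (hLL'.trans (sup_le_sup_left (pow_smul_top_anti (by lia)) _))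
      ((happrox.mono (by lia)).symm_of_moduleHilbertFunction_eq hH.symm)
  exact AdicClose.mono ⟨happrox, hd'.adicApprox hL'L⟩ c.le_succ

theorem exists_bettiNumber_eq_of_moduleHilbertFunction_eq (L : Submodule R E) (p : ℕ) :
    ∃ N₀, ∀ N ≥ N₀, ∀ L' : Submodule R E,
      L' ⊔ maximalIdeal R ^ N • ⊤ = L ⊔ maximalIdeal R ^ N • ⊤ →
      moduleHilbertFunction R (E ⧸ L') = moduleHilbertFunction R (E ⧸ L) →
      ∀ i ≤ p, bettiNumber R (E ⧸ L) i = bettiNumber R (E ⧸ L') i := by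
  obtain ⟨c, hc⟩ := exists_adicClose_imp_bettiNumber_eq p L
  obtain ⟨N₀, h⟩ := exists_adicClose_of_moduleHilbertFunction_eq L c
  exact ⟨N₀, fun N hN L' hL hH => hc L' (h N hN L' hL hH)⟩

end HilbertFunction

end BettiPerturbation

theorem mainTheorem2_general {R : Type u} [CommRing R] [IsLocalRing R] [IsNoetherianRing R]
    {E : Type u} [AddCommGroup E] [Module R E] [Module.Finite R E] (L : Submodule R E) :
    (∀ p : ℕ, ∃ N : ℕ, 0 < N ∧ ∀ L' : Submodule R E,
      L' ⊔ maximalIdeal R ^ N • ⊤ = L ⊔ maximalIdeal R ^ N • ⊤ →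
      BettiPerturbation.moduleHilbertFunction R (E ⧸ L') =
        BettiPerturbation.moduleHilbertFunction R (E ⧸ L) →
      ∀ i ≤ p, BettiPerturbation.bettiNumber R (E ⧸ L) i =
        BettiPerturbation.bettiNumber R (E ⧸ L') i) ∧
    (∃ N₀ : ℕ, ∀ N ≥ N₀, ∀ L' : Submodule R E,
      L' ⊔ maximalIdeal R ^ N • ⊤ = L ⊔ maximalIdeal R ^ N • ⊤ →
      BettiPerturbation.moduleHilbertFunction R (E ⧸ L') =
        BettiPerturbation.moduleHilbertFunction R (E ⧸ L) →
      projectiveDimension (ModuleCat.of R (E ⧸ L)) =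
        projectiveDimension (ModuleCat.of R (E ⧸ L'))) := by
  constructor
  · intro p
    obtain ⟨N₀, hN₀⟩ :=
      BettiPerturbation.exists_bettiNumber_eq_of_moduleHilbertFunction_eq L p
    exact ⟨N₀ + 1, N₀.succ_pos, hN₀ _ N₀.le_succ⟩
  · obtain ⟨b, hb⟩ := BettiPerturbation.exists_projectiveDimension_eq_of_bettiNumber_eq R
    obtain ⟨N₀, hN₀⟩ :=
      BettiPerturbation.exists_bettiNumber_eq_of_moduleHilbertFunction_eq L b
    exact ⟨N₀, fun N hN L' hL hH => hb _ _ (hN₀ N hN L' hL hH)⟩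

theorem mainTheorem2 {R : Type u} [CommRing R] [IsLocalRing R] [IsNoetherianRing R]
    (I : Ideal R) :
    (∀ p : ℕ, ∃ N : ℕ, 0 < N ∧ ∀ J : Ideal R,
      BettiPerturbation.CongrModPow J I N →
      BettiPerturbation.hilbertFunction J = BettiPerturbation.hilbertFunction I →
      ∀ i ≤ p, BettiPerturbation.bettiNumber R (R ⧸ I) i =
        BettiPerturbation.bettiNumber R (R ⧸ J) i) ∧
    (∃ N₀ : ℕ, ∀ N ≥ N₀, ∀ J : Ideal R,
      BettiPerturbation.CongrModPow J I N →
      BettiPerturbation.hilbertFunction J = BettiPerturbation.hilbertFunction I →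
      BettiPerturbation.projDimQuotient I = BettiPerturbation.projDimQuotient J) := by
  simpa only [BettiPerturbation.CongrModPow, BettiPerturbation.projDimQuotient, smul_eq_mul,
    BettiPerturbation.hilbertFunction_eq_moduleHilbertFunction, Ideal.mul_top]
    using mainTheorem2_general (E := R) I
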